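/- For $\epsilon\in[-1/12,1/12]$ let $M^\epsilon$ be the $2\times2$ zero-sum game in which, when the min-player plays row $a$ and the max-player plays column $b$, the loss $\ell\in\{0,1\}$ (minimized by the min-player, maximized by the max-player) is Bernoulli with parameter $M^\epsilon(a,b)$, where $$M^\epsilon=\begin{bmatrix}2/3-\epsilon & 1/3+\epsilon\\ 1/3 & 2/3\end{bmatrix}.$$ For mixed policies $\mu,\nu$ (probability vectors on the two rows, resp. columns) put $L(\mu,\nu)=\sum_{a,b}\mu(a)\nu(b)M^\epsilon(a,b)$, and let $EG(\mu,\nu)=\max_{\nu'}L(\mu,\nu')-\min_{\mu'}L(\mu',\nu)$ be the exploitability gap. The game is played in rounds $t=1,2,\dots$: given the past, $a^t\sim\mu^t$ and $b^t\sim\nu^t$ are sampled independently, and then $\ell^t$ is sampled from the Bernoulli distribution of parameter $M^\epsilon(a^t,b^t)$. The max-player's sampled actions $b^t$ are never observed: a learning sequence is a sequence of profiles $(\mu^t,\nu^t)_{t\ge1}$ in which $\mu^t$ and $\nu^t$ are measurable functions, not depending on $\epsilon$, of $(\omega,a^1,\ell^1,\dots,a^{t-1},\ell^{t-1})$, where $\omega$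 is an internal randomness whose law does not depend on $\epsilon$. For a random variable $X$ write $\|X\|_p=\mathbb E[|X|^p]^{1/p}$. A learning sequence has an $L^p$ last-iterate convergence of rate $f$ in $M^\epsilon$ if $\|EG(\mu^t,\nu^t)\|_p\le f^t$ for all $t\ge1$ when $M^\epsilon$ is played; the convergence is asymptotic if there is a $T_0$, possibly depending on $\epsilon$, such that this holds for all $t\ge T_0$. Let $p\in(0,2]$ and $f^t=\frac{4^{-1/p}}{118}\,t^{-1/(2+p)}$. Then no learning sequence has an $L^p$ last-iterate convergence of rate $f$ simultaneously in all the games $M^\epsilon$, $\epsilon\in[-1/12,1/12]$, not even asymptotically. Consequently, if a learning sequence has an asymptotic $L^p$ last-iterate convergence of rate $g$ in all these games, for some real sequence $g$, then $g^t>\frac{4^{-1/p}}{118}\,t^{-1/(2+p)}$ for infinitely many $t$; that is, the rate is $\Omega(t^{-1/(2+p)})$ in the infinitely-often sense, which is $\Omega(t^{-1/4})$ for $p=2$. -/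

import Mathlib

open MeasureTheory ProbabilityTheory Filter
open scoped ENNReal

noncomputable section

/-! ### Zero-sum matrix games -/

/-- Expected loss `L(μ, ν) = E_{a ∼ μ, b ∼ ν} [L(a, b)]` of a profile of mixed policies. -/
def expectedLoss {A B : Type*} [Fintype A] [Fintype B] (L : A → B → ℝ)
    (μ : stdSimplex ℝ A) (ν : stdSimplex ℝ B) : ℝ :=
  ∑ a, ∑ b, μ a * ν b * L a b

/-- The exploitability gap `max_{ν'} L(μ, ν') - min_{μ'} L(μ', ν)` over mixed policies. Both
extrema are attained, since simplices are compact and `L` is bilinear. -/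
def exploitabilityGap {A B : Type*} [Fintype A] [Fintype B] (L : A → B → ℝ)
    (μ : stdSimplex ℝ A) (ν : stdSimplex ℝ B) : ℝ :=
  -(⨅ μ' : stdSimplex ℝ A, expectedLoss L μ' ν) + ⨆ ν' : stdSimplex ℝ B, expectedLoss L μ ν'

/-- The mean losses (equivalently, the Bernoulli parameters) of the game `M^ε`. Rows are the
actions of the min-player, columns those of the max-player. -/
def gameMatrix (ε : ℝ) : Matrix (Fin 2) (Fin 2) ℝ :=
  !![2 / 3 - ε, 1 / 3 + ε; 1 / 3, 2 / 3]

theorem gameMatrix_mem_Icc {ε : ℝ} (hε : ε ∈ Set.Icc (-1 / 12 : ℝ) (1 / 12)) (a b : Fin 2) :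
    gameMatrix ε a b ∈ Set.Icc (0 : ℝ) 1 := by
  obtain ⟨h1, h2⟩ := hε
  fin_cases a <;> fin_cases b <;> norm_num [gameMatrix] <;> constructor <;> linarith

/-! ### Sampling -/

/-- The Bernoulli distribution of parameter `q`; `true` stands for a loss of `1` and `false` for a
loss of `0`. Only `q ∈ [0, 1]` is ever used (`gameMatrix_mem_Icc`). -/
def bernoulliLaw (q : ℝ) : Measure Bool :=
  bernoulliMeasure true false (Set.projIcc 0 1 zero_le_one q)

/-- The kernel that samples an action from the mixed policy `π z`. -/
def actionKernel {Z : Type*} [MeasurableSpace Z] (π : Z → stdSimplex ℝ (Fin 2))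
    (hπ : Measurable π) : Kernel Z (Fin 2) where
  toFun z := ∑ a, ENNReal.ofReal (π z a) • Measure.dirac a
  measurable' := by
    refine Measure.measurable_of_measurable_coe _ fun s _ => ?_
    simp only [Measure.coe_finsetSum, Finset.sum_apply, Measure.smul_apply, smul_eq_mul]
    refine Finset.measurable_sum _ fun a _ => Measurable.mul_const ?_ _
    exact ENNReal.measurable_ofReal.comp
      ((measurable_pi_apply a).comp (measurable_subtype_coe.comp hπ))

/-- The kernel that samples the loss, given the pair of actions, in the game `M^ε`. -/
def lossKernel (ε : ℝ) : Kernel (Fin 2 × Fin 2) Bool :=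
  ⟨fun ab => bernoulliLaw (gameMatrix ε ab.1 ab.2), measurable_of_countable _⟩

/-! ### Learning sequences -/

/-- What happens in one round: the actions `a`, `b` of the two players and the loss `ℓ`, stored as
`((a, b), ℓ)`. -/
abbrev Round : Type := (Fin 2 × Fin 2) × Bool

/-- What is observed in a round: the action `a` of the min-player and the loss `ℓ`. The sampled
action of the max-player is not observed. -/
abbrev Observation : Type := Fin 2 × Bool

/-- The observed part of a history of `n` rounds, together with the internal randomness. -/
def observed {W : Type*} {n : ℕ} (z : W × (Fin n → Round)) : W × (Fin n → Observation) :=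
  (z.1, fun i => ((z.2 i).1.1, (z.2 i).2))

/-- A learning sequence with internal randomness in `W`. The profile `(minPolicy n, maxPolicy n)` is
the one of round `n + 1`: it is a measurable function of the internal randomness and of the
observations of the `n` preceding rounds, that is, the sequence is predictable for the filtration
generated by `(ω, a¹, ℓ¹, a², ℓ², …)`. -/
structure LearningSequence (W : Type*) [MeasurableSpace W] where
  minPolicy : (n : ℕ) → W × (Fin n → Observation) → stdSimplex ℝ (Fin 2)
  maxPolicy : (n : ℕ) → W × (Fin n → Observation) → stdSimplex ℝ (Fin 2)
  measurable_minPolicy : ∀ n, Measurable (minPolicy n)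
  measurable_maxPolicy : ∀ n, Measurable (maxPolicy n)

section LearningSequences

variable {W : Type*} [MeasurableSpace W]

theorem measurable_observed {n : ℕ} :
    Measurable (observed : W × (Fin n → Round) → W × (Fin n → Observation)) :=
  measurable_fst.prodMk ((measurable_of_countable
    (fun (h : Fin n → Round) (i : Fin n) => ((h i).1.1, (h i).2))).comp measurable_snd)

/-- The law of round `n + 1` in the game `M^ε`, given the past: the two actions are sampled
independently from the current profile, then the loss is sampled given the two actions. -/
def roundKernel (S : LearningSequence W) (ε : ℝ) (n : ℕ) :
    Kernel (W × (Fin n → Round)) Round :=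
  ((actionKernel (fun z => S.minPolicy n (observed z))
      ((S.measurable_minPolicy n).comp measurable_observed)) ×ₖ
    (actionKernel (fun z => S.maxPolicy n (observed z))
      ((S.measurable_maxPolicy n).comp measurable_observed))) ⊗ₖ
    ((lossKernel ε).comap Prod.snd measurable_snd)

/-- The law of the internal randomness and of the first `n` rounds, when the learning sequence `S`
plays the game `M^ε` and the internal randomness has law `ρ`. -/
def runLaw (S : LearningSequence W) (ρ : Measure W) (ε : ℝ) :
    (n : ℕ) → Measure (W × (Fin n → Round))
  | 0 => ρ.map fun w => (w, Fin.elim0)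
  | n + 1 => (runLaw S ρ ε n ⊗ₘ roundKernel S ε n).map
      fun x => (x.1.1, (Fin.snoc x.1.2 x.2 : Fin (n + 1) → Round))

/-- `‖EG(μᵗ, νᵗ)‖_p = E[|EG(μᵗ, νᵗ)|^p]^{1/p}` for the round `t = n + 1` of the game `M^ε`. -/
def gapNorm (S : LearningSequence W) (ρ : Measure W) (ε p : ℝ) (n : ℕ) : ℝ≥0∞ :=
  eLpNorm (fun z => exploitabilityGap (gameMatrix ε)
    (S.minPolicy n (observed z)) (S.maxPolicy n (observed z))) (ENNReal.ofReal p) (runLaw S ρ ε n)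

/-- `L^p` last-iterate convergence of rate `f` in the game `M^ε`: `‖EG(μᵗ, νᵗ)‖_p ≤ fᵗ` for all
rounds `t ≥ 1`, where `t = n + 1`. -/
def HasLastIterateRate (S : LearningSequence W) (ρ : Measure W) (ε p : ℝ) (f : ℕ → ℝ) : Prop :=
  ∀ n : ℕ, gapNorm S ρ ε p n ≤ ENNReal.ofReal (f (n + 1))

/-- Asymptotic `L^p` last-iterate convergence of rate `f` in the game `M^ε`:
`‖EG(μᵗ, νᵗ)‖_p ≤ fᵗ` for all rounds `t = n + 1` from some `T₀` on. -/
def HasAsymptoticLastIterateRate (S : LearningSequence W) (ρ : Measure W) (ε p : ℝ)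
    (f : ℕ → ℝ) : Prop :=
  ∃ T₀ : ℕ, ∀ n : ℕ, T₀ ≤ n + 1 → gapNorm S ρ ε p n ≤ ENNReal.ofReal (f (n + 1))

/-- The rate `fᵗ = 4^{-1/p} / 118 * t^{-1/(2+p)}`. -/
def lowerRate (p : ℝ) (t : ℕ) : ℝ :=
  (4 : ℝ) ^ (-1 / p) / 118 * (t : ℝ) ^ (-1 / (2 + p))

/-! ### The laws above are probability measures -/

instance isMarkovKernel_actionKernel {Z : Type*} [MeasurableSpace Z]
    (π : Z → stdSimplex ℝ (Fin 2)) (hπ : Measurable π) : IsMarkovKernel (actionKernel π hπ) := by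
  refine ⟨fun z => ⟨?_⟩⟩
  have h0 : ∀ a, 0 ≤ π z a := (π z).2.1
  have h1 : ∑ a, π z a = 1 := (π z).2.2
  rw [Fin.sum_univ_two] at h1
  change (∑ a, ENNReal.ofReal (π z a) • Measure.dirac a : Measure (Fin 2)) Set.univ = 1
  simp only [Fin.sum_univ_two, Measure.add_apply, Measure.smul_apply, measure_univ, smul_eq_mul,
    mul_one]
  rw [← ENNReal.ofReal_add (h0 0) (h0 1), h1, ENNReal.ofReal_one]

instance isMarkovKernel_lossKernel (ε : ℝ) : IsMarkovKernel (lossKernel ε) :=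
  ⟨fun ab => inferInstanceAs (IsProbabilityMeasure (bernoulliMeasure true false
    (Set.projIcc 0 1 zero_le_one (gameMatrix ε ab.1 ab.2))))⟩

instance isMarkovKernel_roundKernel (S : LearningSequence W) (ε : ℝ) (n : ℕ) :
    IsMarkovKernel (roundKernel S ε n) := by
  unfold roundKernel
  infer_instance

theorem measurable_snocRound {n : ℕ} :
    Measurable fun x : (W × (Fin n → Round)) × Round =>
      (x.1.1, (Fin.snoc x.1.2 x.2 : Fin (n + 1) → Round)) :=
  (measurable_fst.comp measurable_fst).prodMk
    ((measurable_of_countable fun y : (Fin n → Round) × Round =>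
      (Fin.snoc y.1 y.2 : Fin (n + 1) → Round)).comp
      ((measurable_snd.comp measurable_fst).prodMk measurable_snd))

instance isProbabilityMeasure_runLaw (S : LearningSequence W) (ρ : Measure W)
    [IsProbabilityMeasure ρ] (ε : ℝ) (n : ℕ) : IsProbabilityMeasure (runLaw S ρ ε n) := by
  induction n with
  | zero =>
    exact Measure.isProbabilityMeasure_map (measurable_id.prodMk measurable_const).aemeasurable
  | succ n ih => exact Measure.isProbabilityMeasure_map measurable_snocRound.aemeasurable

end LearningSequences

end

noncomputable section


/-! ### The exploitability gap of `M^ε` -/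

/-! In every game `M^ε` the value is `1/2` and the max-player's equilibrium is uniform, while the
min-player's equilibrium `μ 0 = 1 / (2 - 6ε)` moves with `ε`. Against the uniform column policy both
rows have mean loss `1/2` whatever `ε` is, so the observations say nothing about `ε`. Convergence of
the max-player thus starves the min-player of the information that its own convergence needs.

Quantitatively, let `v` be the column deviation and `d = ε' - ε`. A round lowers the affinity (the
sum of `√(PQ)`) of the two observation laws by a factor at least `1 - 4 d² v²`. The rate gives
`E[v²] ≲ t^(-p/(2+p))`, so the information collected in `n` rounds is of order `d² n^(2/(2+p))`. At
a horizon with `d ≍ n^(-1/(2+p))` this stays small, and Le Cam's bound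
`three_quarters_le_measure_add` forces in one of the games a row deviation of order `d` with more
than the probability that the rate allows. This is `not_forall_gapNorm_le_of_close`.

In the asymptotic version `T₀` depends on `ε`. Since there are uncountably many `ε`, some `T₀`
serves an uncountable set of them, and that set contains pairs at arbitrarily small distance
(`exists_mem_forall_gt_exists_mem_Ioo`). The first `T₀` rounds then contribute only about `d² T₀`.
-/

theorem stdSimplex_fin_two_one (μ : stdSimplex ℝ (Fin 2)) : μ 1 = 1 - μ 0 := by
  have h : ∑ a, μ a = 1 := μ.2.2
  rw [Fin.sum_univ_two] at h
  linarith

theorem abs_expectedLoss_le {A B : Type*} [Fintype A] [Fintype B] (L : A → B → ℝ)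
    (μ : stdSimplex ℝ A) (ν : stdSimplex ℝ B) :
    |expectedLoss L μ ν| ≤ ∑ a, ∑ b, |L a b| := by
  refine (Finset.abs_sum_le_sum_abs _ _).trans (Finset.sum_le_sum fun a _ => ?_)
  refine (Finset.abs_sum_le_sum_abs _ _).trans (Finset.sum_le_sum fun b _ => ?_)
  have ha : μ a ∈ Set.Icc (0 : ℝ) 1 := mem_Icc_of_mem_stdSimplex μ.2 a
  have hb : ν b ∈ Set.Icc (0 : ℝ) 1 := mem_Icc_of_mem_stdSimplex ν.2 b
  rw [abs_mul, abs_of_nonneg (mul_nonneg ha.1 hb.1)]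
  exact mul_le_of_le_one_left (abs_nonneg _) (mul_le_one₀ ha.2 hb.1 hb.2)

theorem sub_le_exploitabilityGap {A B : Type*} [Fintype A] [Fintype B] (L : A → B → ℝ)
    (μ μ' : stdSimplex ℝ A) (ν ν' : stdSimplex ℝ B) :
    expectedLoss L μ ν' - expectedLoss L μ' ν ≤ exploitabilityGap L μ ν := by
  have h1 : expectedLoss L μ ν' ≤ ⨆ ν' : stdSimplex ℝ B, expectedLoss L μ ν' :=
    le_ciSup ⟨_, Set.forall_mem_range.2 fun ν' => (le_abs_self _).trans
      (abs_expectedLoss_le L μ ν')⟩ ν'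
  have h2 : ⨅ μ' : stdSimplex ℝ A, expectedLoss L μ' ν ≤ expectedLoss L μ' ν :=
    ciInf_le ⟨_, Set.forall_mem_range.2 fun μ' => (abs_le.1 (abs_expectedLoss_le L μ' ν)).1⟩ μ'
  unfold exploitabilityGap
  linarith

/-- The deviation of the first row's weight from its equilibrium value, scaled so that the best
response to `μ` in `M^ε` has the value `1 / 2 + |rowDeviation ε μ|`. -/
def rowDeviation (ε : ℝ) (μ : stdSimplex ℝ (Fin 2)) : ℝ := μ 0 * (1 / 3 - ε) - 1 / 6

/-- The deviation of the first column's weight from its equilibrium value `1 / 2`. -/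
def colDeviation (ν : stdSimplex ℝ (Fin 2)) : ℝ := ν 0 - 1 / 2

theorem pure_sub_pure_le_exploitabilityGap (ε : ℝ) (μ ν : stdSimplex ℝ (Fin 2)) (a b : Fin 2) :
    (μ 0 * gameMatrix ε 0 b + μ 1 * gameMatrix ε 1 b) -
      (ν 0 * gameMatrix ε a 0 + ν 1 * gameMatrix ε a 1) ≤
      exploitabilityGap (gameMatrix ε) μ ν := by
  refine le_trans (le_of_eq ?_) (sub_le_exploitabilityGap (gameMatrix ε) μ
    ⟨Pi.single a 1, single_mem_stdSimplex ℝ a⟩ ν ⟨Pi.single b 1, single_mem_stdSimplex ℝ b⟩)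
  have hs : ∀ i j : Fin 2, (⟨Pi.single i 1, single_mem_stdSimplex ℝ i⟩ : stdSimplex ℝ (Fin 2)) j =
    (Pi.single i 1 : Fin 2 → ℝ) j := fun _ _ => rfl
  simp only [expectedLoss, Fin.sum_univ_two, hs]
  fin_cases a <;> fin_cases b <;> simp

/-- The two columns yield `1/2 ± rowDeviation ε μ`, and the two rows yield `1/2 + (1/3 - 2ε) v` and
`1/2 - v/3` with `v = colDeviation ν`. Picking the better pure response of each player gives the
bound; `1/6` is the least value of `1/3 - 2ε`. -/
theorem deviations_le_exploitabilityGap {ε : ℝ} (hε : ε ∈ Set.Icc (-1 / 12 : ℝ) (1 / 12))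
    (μ ν : stdSimplex ℝ (Fin 2)) :
    |rowDeviation ε μ| + |colDeviation ν| / 6 ≤ exploitabilityGap (gameMatrix ε) μ ν := by
  obtain ⟨h1, h2⟩ := hε
  have h := pure_sub_pure_le_exploitabilityGap ε μ ν
  generalize exploitabilityGap (gameMatrix ε) μ ν = E at h ⊢
  have h00 := h 0 0
  have h01 := h 0 1
  have h10 := h 1 0
  have h11 := h 1 1
  simp only [stdSimplex_fin_two_one, gameMatrix, Matrix.of_apply, Matrix.cons_val',
    Matrix.cons_val_zero,
    Matrix.cons_val_one, Matrix.cons_val_fin_one] at h00 h01 h10 h11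
  unfold rowDeviation colDeviation
  rcases abs_cases (μ 0 * (1 / 3 - ε) - 1 / 6) with ⟨e1, _⟩ | ⟨e1, _⟩ <;>
    rcases abs_cases (ν 0 - 1 / 2) with ⟨e2, _⟩ | ⟨e2, _⟩ <;> rw [e1, e2] <;> nlinarith

theorem measurable_colDeviation : Measurable colDeviation :=
  ((measurable_pi_apply 0).comp measurable_subtype_coe).sub_const _

theorem measurable_rowDeviation (ε : ℝ) : Measurable (rowDeviation ε) :=
  (((measurable_pi_apply 0).comp measurable_subtype_coe).mul_const _).sub_const _

theorem abs_colDeviation_le (ν : stdSimplex ℝ (Fin 2)) : |colDeviation ν| ≤ 1 / 2 := by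
  have h : ν 0 ∈ Set.Icc (0 : ℝ) 1 := mem_Icc_of_mem_stdSimplex ν.2 0
  unfold colDeviation
  rw [abs_le]
  constructor <;> linarith [h.1, h.2]

/-- No row policy is good in both games: eliminating `μ 0` leaves a combination of the two
deviations, with coefficients at most `5/12`, equal to `(ε' - ε)/6`. -/
theorem le_abs_rowDeviation_of_lt {ε ε' : ℝ} (hε : ε ∈ Set.Icc (-1 / 12 : ℝ) (1 / 12))
    (hε' : ε' ∈ Set.Icc (-1 / 12 : ℝ) (1 / 12)) (μ : stdSimplex ℝ (Fin 2))
    (h : |rowDeviation ε μ| < (ε' - ε) / 5) : (ε' - ε) / 5 ≤ |rowDeviation ε' μ| := by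
  have key : (1 / 3 - ε') * rowDeviation ε μ - (1 / 3 - ε) * rowDeviation ε' μ =
      (ε' - ε) / 6 := by
    unfold rowDeviation
    ring
  have h1 : (1 / 3 - ε') * rowDeviation ε μ ≤ 5 / 12 * |rowDeviation ε μ| := by
    nlinarith [hε'.1, hε'.2, le_abs_self (rowDeviation ε μ), abs_nonneg (rowDeviation ε μ)]
  have h2 : -((1 / 3 - ε) * rowDeviation ε' μ) ≤ 5 / 12 * |rowDeviation ε' μ| := by
    nlinarith [hε.1, hε.2, neg_abs_le (rowDeviation ε' μ), abs_nonneg (rowDeviation ε' μ)]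
  linarith

/-! ### The law of the observations -/

/-- The probability that a Bernoulli variable of parameter `q` takes the value `ℓ`. -/
def bernoulliProb (q : ℝ) (ℓ : Bool) : ℝ := cond ℓ q (1 - q)

/-- The mean loss of the action `a` against the mixed policy `ν` in the game `M^ε`. -/
def rowLoss (ε : ℝ) (ν : stdSimplex ℝ (Fin 2)) (a : Fin 2) : ℝ :=
  ν 0 * gameMatrix ε a 0 + ν 1 * gameMatrix ε a 1

/-- The probability of the observation `o` in a round of `M^ε` played with the profile `(μ, ν)`. -/
def observationProb (ε : ℝ) (μ ν : stdSimplex ℝ (Fin 2)) (o : Observation) : ℝ :=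
  μ o.1 * bernoulliProb (rowLoss ε ν o.1) o.2

theorem bernoulliProb_nonneg {q : ℝ} (hq : q ∈ Set.Icc (0 : ℝ) 1) (ℓ : Bool) :
    0 ≤ bernoulliProb q ℓ := by
  cases ℓ
  · exact sub_nonneg.2 hq.2
  · exact hq.1

theorem rowLoss_mem_Icc {ε : ℝ} (hε : ε ∈ Set.Icc (-1 / 12 : ℝ) (1 / 12))
    (ν : stdSimplex ℝ (Fin 2)) (a : Fin 2) : rowLoss ε ν a ∈ Set.Icc (1 / 4 : ℝ) (3 / 4) := by
  have h : ν 0 ∈ Set.Icc (0 : ℝ) 1 := mem_Icc_of_mem_stdSimplex ν.2 0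
  obtain ⟨h0, h1⟩ := h
  obtain ⟨h2, h3⟩ := hε
  rw [rowLoss, stdSimplex_fin_two_one]
  fin_cases a <;> simp [gameMatrix] <;> constructor <;> nlinarith

theorem observationProb_nonneg {ε : ℝ} (hε : ε ∈ Set.Icc (-1 / 12 : ℝ) (1 / 12))
    (μ ν : stdSimplex ℝ (Fin 2)) (o : Observation) : 0 ≤ observationProb ε μ ν o :=
  mul_nonneg (μ.2.1 _) (bernoulliProb_nonneg
    (Set.Icc_subset_Icc (by norm_num) (by norm_num) (rowLoss_mem_Icc hε ν o.1)) _)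

theorem sum_observationProb (ε : ℝ) (μ ν : stdSimplex ℝ (Fin 2)) :
    ∑ o, observationProb ε μ ν o = 1 := by
  simp only [observationProb, bernoulliProb, Fintype.sum_prod_type, Fin.sum_univ_two,
    Fintype.sum_bool, cond_true, cond_false, stdSimplex_fin_two_one μ]
  ring

theorem sum_fin_succ_eq_sum_snoc {X M : Type*} [Fintype X] [AddCommMonoid M] {n : ℕ}
    (f : (Fin (n + 1) → X) → M) :
    ∑ h, f h = ∑ h : Fin n → X, ∑ x, f (Fin.snoc h x : Fin (n + 1) → X) := by
  rw [← (Fin.snocEquiv fun _ : Fin (n + 1) => X).sum_comp, Fintype.sum_prod_type_right]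
  rfl

theorem observed_snoc {W : Type*} {n : ℕ} (z : W × (Fin n → Round)) (r : Round) :
    observed (z.1, (Fin.snoc z.2 r : Fin (n + 1) → Round)) =
      (z.1, (Fin.snoc (observed z).2 (r.1.1, r.2) : Fin (n + 1) → Observation)) := by
  refine Prod.ext rfl (funext fun i => ?_)
  refine Fin.lastCases ?_ (fun j => ?_) i
  · simp [observed]
  · simp [observed]

section LearningSequences

variable {W : Type*} [MeasurableSpace W]

theorem lintegral_actionKernel {Z : Type*} [MeasurableSpace Z]
    (π : Z → stdSimplex ℝ (Fin 2)) (hπ : Measurable π) (z : Z) (f : Fin 2 → ℝ≥0∞) :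
    ∫⁻ a, f a ∂actionKernel π hπ z = ∑ a, ENNReal.ofReal (π z a) * f a := by
  change ∫⁻ a, f a ∂(∑ a, ENNReal.ofReal (π z a) • Measure.dirac a : Measure (Fin 2)) = _
  rw [lintegral_finsetSum_measure]
  simp

theorem lintegral_lossKernel {ε : ℝ} (hε : ε ∈ Set.Icc (-1 / 12 : ℝ) (1 / 12))
    (ab : Fin 2 × Fin 2) (f : Bool → ℝ≥0∞) :
    ∫⁻ ℓ, f ℓ ∂lossKernel ε ab =
      ∑ ℓ, ENNReal.ofReal (bernoulliProb (gameMatrix ε ab.1 ab.2) ℓ) * f ℓ := by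
  have h := gameMatrix_mem_Icc hε ab.1 ab.2
  change ∫⁻ ℓ, f ℓ ∂bernoulliMeasure true false (Set.projIcc 0 1 zero_le_one _) = _
  rw [Set.projIcc_of_mem _ h, bernoulliMeasure_def, lintegral_add_measure]
  simp only [Fintype.sum_bool, bernoulliProb, cond_true, cond_false]
  congr 1
  · rw [ENNReal.smul_def, lintegral_smul_measure, lintegral_dirac, smul_eq_mul,
      ENNReal.ofReal_eq_coe_nnreal h.1]
    rfl
  · rw [ENNReal.smul_def, lintegral_smul_measure, lintegral_dirac, smul_eq_mul,
      ENNReal.ofReal_eq_coe_nnreal (sub_nonneg.2 h.2)]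
    rfl

/-- A Bernoulli law is affine in its parameter, so averaging over the hidden column leaves a
Bernoulli loss whose parameter is the mean `rowLoss`. -/
theorem lintegral_roundKernel (S : LearningSequence W) {ε : ℝ}
    (hε : ε ∈ Set.Icc (-1 / 12 : ℝ) (1 / 12)) {n : ℕ} (z : W × (Fin n → Round))
    (f : Observation → ℝ≥0∞) :
    ∫⁻ r, f (r.1.1, r.2) ∂roundKernel S ε n z =
      ∑ o, ENNReal.ofReal (observationProb ε (S.minPolicy n (observed z))
        (S.maxPolicy n (observed z)) o) * f o := by
  rw [roundKernel, Kernel.lintegral_compProd _ _ _ (measurable_of_countable _)]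
  simp only [Kernel.comap_apply, lintegral_lossKernel hε]
  rw [Kernel.lintegral_prod _ _ _ (measurable_of_countable _)]
  simp only [lintegral_actionKernel]
  generalize S.minPolicy n (observed z) = μ
  generalize S.maxPolicy n (observed z) = ν
  have key : ∀ a ℓ, ENNReal.ofReal (observationProb ε μ ν (a, ℓ)) = ENNReal.ofReal (μ a) *
      ∑ b, ENNReal.ofReal (ν b) * ENNReal.ofReal (bernoulliProb (gameMatrix ε a b) ℓ) := by
    intro a ℓ
    have h0 : ∀ b, 0 ≤ bernoulliProb (gameMatrix ε a b) ℓ := fun b =>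
      bernoulliProb_nonneg (gameMatrix_mem_Icc hε a b) ℓ
    have hν : ∀ b, 0 ≤ ν b := ν.2.1
    have hμ : 0 ≤ μ a := μ.2.1 a
    rw [Fin.sum_univ_two, ← ENNReal.ofReal_mul (hν 0), ← ENNReal.ofReal_mul (hν 1),
      ← ENNReal.ofReal_add (mul_nonneg (hν 0) (h0 0)) (mul_nonneg (hν 1) (h0 1)),
      ← ENNReal.ofReal_mul hμ, observationProb, rowLoss]
    congr 2
    have h1 := stdSimplex_fin_two_one ν
    cases ℓ
    · change 1 - (_ + _) = _ * (1 - _) + _ * (1 - _)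
      rw [h1]
      ring
    · rfl
  simp only [Fintype.sum_prod_type, key, Fin.sum_univ_two, Fintype.sum_bool]
  ring

/-- The density, with respect to the law of the internal randomness and the counting measure on
histories, of the observed part of a run in the game `M^ε`. -/
def observationDensity (S : LearningSequence W) (ε : ℝ) :
    (n : ℕ) → W → (Fin n → Observation) → ℝ
  | 0 => fun _ _ => 1
  | n + 1 => fun w h => observationDensity S ε n w (Fin.init h) *
      observationProb ε (S.minPolicy n (w, Fin.init h)) (S.maxPolicy n (w, Fin.init h))
        (h (Fin.last n))

theorem observationDensity_nonneg (S : LearningSequence W) {ε : ℝ}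
    (hε : ε ∈ Set.Icc (-1 / 12 : ℝ) (1 / 12)) (n : ℕ) (w : W) (h : Fin n → Observation) :
    0 ≤ observationDensity S ε n w h := by
  induction n with
  | zero => exact zero_le_one
  | succ n ih => exact mul_nonneg (ih _) (observationProb_nonneg hε _ _ _)

theorem observationDensity_snoc (S : LearningSequence W) (ε : ℝ) {n : ℕ} (w : W)
    (h : Fin n → Observation) (o : Observation) :
    observationDensity S ε (n + 1) w (Fin.snoc h o : Fin (n + 1) → Observation) =
      observationDensity S ε n w h *
        observationProb ε (S.minPolicy n (w, h)) (S.maxPolicy n (w, h)) o := by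
  simp only [observationDensity, Fin.init_snoc, Fin.snoc_last]

theorem measurable_observationProb (S : LearningSequence W) (ε : ℝ) (n : ℕ) (o : Observation) :
    Measurable fun z => observationProb ε (S.minPolicy n z) (S.maxPolicy n z) o := by
  have hc : ∀ i : Fin 2, Measurable fun μ : stdSimplex ℝ (Fin 2) => μ i := fun i =>
    (measurable_pi_apply i).comp measurable_subtype_coe
  refine ((hc o.1).comp (S.measurable_minPolicy n)).mul ?_
  have hr : Measurable fun z => rowLoss ε (S.maxPolicy n z) o.1 :=
    (((hc 0).comp (S.measurable_maxPolicy n)).mul_const _).add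
      (((hc 1).comp (S.measurable_maxPolicy n)).mul_const _)
  cases o.2
  · exact hr.const_sub 1
  · exact hr

theorem measurable_observationDensity (S : LearningSequence W) (ε : ℝ) (n : ℕ)
    (h : Fin n → Observation) : Measurable fun w => observationDensity S ε n w h := by
  induction n with
  | zero => exact measurable_const
  | succ n ih => exact (ih _).mul ((measurable_observationProb S ε n _).comp measurable_prodMk_right)

theorem sum_observationDensity (S : LearningSequence W) (ε : ℝ) (n : ℕ) (w : W) :
    ∑ h, observationDensity S ε n w h = 1 := by
  induction n with
  | zero => simp [observationDensity]
  | succ n ih =>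
    rw [sum_fin_succ_eq_sum_snoc]
    simp only [observationDensity_snoc, ← Finset.mul_sum, sum_observationProb, mul_one, ih]

theorem lintegral_runLaw_observed (S : LearningSequence W) (ρ : Measure W)
    [IsProbabilityMeasure ρ] {ε : ℝ} (hε : ε ∈ Set.Icc (-1 / 12 : ℝ) (1 / 12)) {n : ℕ}
    {f : W × (Fin n → Observation) → ℝ≥0∞} (hf : Measurable f) :
    ∫⁻ z, f (observed z) ∂runLaw S ρ ε n =
      ∫⁻ w, ∑ h, ENNReal.ofReal (observationDensity S ε n w h) * f (w, h) ∂ρ := by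
  induction n with
  | zero =>
    refine (lintegral_map (hf.comp measurable_observed)
      (measurable_id.prodMk measurable_const)).trans (lintegral_congr fun w => ?_)
    rw [Fintype.sum_unique]
    simp only [observationDensity, ENNReal.ofReal_one, one_mul]
    exact congrArg f (Prod.ext rfl (Subsingleton.elim _ _))
  | succ n ih =>
    have hm : Measurable fun z : W × (Fin n → Observation) =>
        ∑ o, ENNReal.ofReal (observationProb ε (S.minPolicy n z) (S.maxPolicy n z) o) *
          f (z.1, (Fin.snoc z.2 o : Fin (n + 1) → Observation)) := by
      refine Finset.measurable_sum _ fun o _ => Measurable.mul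
        (ENNReal.measurable_ofReal.comp (measurable_observationProb S ε n o)) (hf.comp ?_)
      exact measurable_fst.prodMk ((measurable_of_countable
          fun h : Fin n → Observation => (Fin.snoc h o : Fin (n + 1) → Observation)).comp
            measurable_snd)
    refine ((lintegral_map (hf.comp measurable_observed) measurable_snocRound).trans
      (Measure.lintegral_compProd
        ((hf.comp measurable_observed).comp measurable_snocRound))).trans ?_
    simp only [Function.comp_apply]
    have hstep : ∀ z : W × (Fin n → Round), ∫⁻ r, f (observed
        (z.1, (Fin.snoc z.2 r : Fin (n + 1) → Round))) ∂roundKernel S ε n z =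
        ∑ o, ENNReal.ofReal (observationProb ε (S.minPolicy n (observed z))
          (S.maxPolicy n (observed z)) o) *
          f ((observed z).1, (Fin.snoc (observed z).2 o : Fin (n + 1) → Observation)) := by
      intro z
      simp only [observed_snoc]
      exact lintegral_roundKernel S hε z
        fun o => f (z.1, (Fin.snoc (observed z).2 o : Fin (n + 1) → Observation))
    simp only [hstep]
    rw [ih hm]
    refine lintegral_congr fun w => ?_
    rw [sum_fin_succ_eq_sum_snoc]
    refine Finset.sum_congr rfl fun h _ => ?_
    rw [Finset.mul_sum]
    refine Finset.sum_congr rfl fun o _ => ?_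
    rw [observationDensity_snoc, ENNReal.ofReal_mul (observationDensity_nonneg S hε n w h),
      mul_assoc]

end LearningSequences

/-! ### The affinity of two observation laws -/

/-- The defect `(x + y)/2 - √(xy)` equals `(√x - √y)²/2`, while `(x - y)² = (√x - √y)² (√x + √y)²`
with `√x + √y ≥ 1`. -/
theorem half_add_sub_le_sqrt_mul {x y : ℝ} (hx : 1 / 4 ≤ x) (hy : 1 / 4 ≤ y) :
    (x + y) / 2 - (x - y) ^ 2 / 2 ≤ √(x * y) := by
  have hx0 : 0 ≤ x := by linarith
  have hy0 : 0 ≤ y := by linarith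
  have h1 : 1 / 2 ≤ √x := Real.le_sqrt_of_sq_le (by linarith)
  have h2 : 1 / 2 ≤ √y := Real.le_sqrt_of_sq_le (by linarith)
  rw [Real.sqrt_mul hx0]
  obtain ⟨s, hs⟩ : ∃ s, s = √x := ⟨_, rfl⟩
  obtain ⟨t, ht⟩ : ∃ t, t = √y := ⟨_, rfl⟩
  have hxs : x = s ^ 2 := by rw [hs, Real.sq_sqrt hx0]
  have hyt : y = t ^ 2 := by rw [ht, Real.sq_sqrt hy0]
  rw [← hs] at h1 ⊢
  rw [← ht] at h2 ⊢
  have h3 : 0 ≤ (s - t) ^ 2 * ((s + t) ^ 2 - 1) := mul_nonneg (sq_nonneg _) (by nlinarith)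
  rw [hxs, hyt]
  nlinarith

/-- A pointwise lower bound for `min x y` that is linear in `√(xy)`, so that it can be summed over
histories and integrated over `ω` directly. For two probability laws of affinity `1` it sums to `2 -
5/4 = 3/4`, which leaves room above the two error probabilities `1/4`. -/
theorem two_mul_sqrt_mul_sub_le_left {x y : ℝ} (hx : 0 ≤ x) (hy : 0 ≤ y) :
    2 * √(x * y) - 5 / 8 * (x + y) ≤ x := by
  rw [Real.sqrt_mul hx]
  nlinarith [Real.sq_sqrt hx, Real.sq_sqrt hy, sq_nonneg (13 * √x - 8 * √y), sq_nonneg (√y)]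

/-- Only the first row depends on `ε`, and there the effect is `∓ε` on the two columns, which
cancels at the uniform policy. -/
theorem sq_rowLoss_sub_le (ε ε' : ℝ) (ν : stdSimplex ℝ (Fin 2)) (a : Fin 2) :
    (rowLoss ε ν a - rowLoss ε' ν a) ^ 2 ≤ 4 * (ε' - ε) ^ 2 * colDeviation ν ^ 2 := by
  rw [rowLoss, rowLoss, stdSimplex_fin_two_one, colDeviation]
  fin_cases a <;> simp [gameMatrix]
  · exact le_of_eq (by ring)
  · positivity

theorem one_sub_le_sum_sqrt_observationProb {ε ε' : ℝ}
    (hε : ε ∈ Set.Icc (-1 / 12 : ℝ) (1 / 12)) (hε' : ε' ∈ Set.Icc (-1 / 12 : ℝ) (1 / 12))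
    (μ ν : stdSimplex ℝ (Fin 2)) :
    1 - 4 * (ε' - ε) ^ 2 * colDeviation ν ^ 2 ≤
      ∑ o, √(observationProb ε μ ν o * observationProb ε' μ ν o) := by
  have hμ : ∀ a, 0 ≤ μ a := μ.2.1
  have h1 := stdSimplex_fin_two_one μ
  have hrow : ∀ a, 1 - 4 * (ε' - ε) ^ 2 * colDeviation ν ^ 2 ≤
      ∑ ℓ, √(bernoulliProb (rowLoss ε ν a) ℓ * bernoulliProb (rowLoss ε' ν a) ℓ) := by
    intro a
    have h := sq_rowLoss_sub_le ε ε' ν a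
    obtain ⟨l1, u1⟩ := rowLoss_mem_Icc hε ν a
    obtain ⟨l2, u2⟩ := rowLoss_mem_Icc hε' ν a
    have ht := half_add_sub_le_sqrt_mul l1 l2
    have hf := half_add_sub_le_sqrt_mul (x := 1 - rowLoss ε ν a) (y := 1 - rowLoss ε' ν a)
      (by linarith) (by linarith)
    simp only [Fintype.sum_bool, bernoulliProb, cond_true, cond_false]
    nlinarith
  have hfac : ∀ a ℓ, √(observationProb ε μ ν (a, ℓ) * observationProb ε' μ ν (a, ℓ)) =
      μ a * √(bernoulliProb (rowLoss ε ν a) ℓ * bernoulliProb (rowLoss ε' ν a) ℓ) := by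
    intro a ℓ
    rw [observationProb, observationProb, mul_mul_mul_comm, Real.sqrt_mul (mul_self_nonneg _),
      Real.sqrt_mul_self (hμ a)]
  simp only [Fintype.sum_prod_type, hfac, ← Finset.mul_sum]
  rw [Fin.sum_univ_two]
  have h2 := mul_le_mul_of_nonneg_left (hrow 0) (hμ 0)
  have h3 := mul_le_mul_of_nonneg_left (hrow 1) (hμ 1)
  rw [h1] at h3 ⊢
  linarith

section LearningSequences

variable {W : Type*} [MeasurableSpace W]

/-- Affinity is multiplicative along the history. Bounding `√(PQ)` by `(P + Q)/2` in the loss of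
each round turns it into second moments of `v` under the two runs, which the convergence hypotheses
control. -/
theorem one_sub_le_sum_sqrt_observationDensity (S : LearningSequence W) {ε ε' : ℝ}
    (hε : ε ∈ Set.Icc (-1 / 12 : ℝ) (1 / 12)) (hε' : ε' ∈ Set.Icc (-1 / 12 : ℝ) (1 / 12))
    (w : W) (n : ℕ) :
    1 - 2 * (ε' - ε) ^ 2 * ∑ i ∈ Finset.range n, ∑ h,
      (observationDensity S ε i w h + observationDensity S ε' i w h) *
        colDeviation (S.maxPolicy i (w, h)) ^ 2 ≤
      ∑ h, √(observationDensity S ε n w h * observationDensity S ε' n w h) := by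
  induction n with
  | zero => simp [observationDensity]
  | succ n ih =>
    rw [sum_fin_succ_eq_sum_snoc, Finset.sum_range_succ, mul_add]
    have hstep : ∀ h : Fin n → Observation,
        √(observationDensity S ε n w h * observationDensity S ε' n w h) -
          2 * (ε' - ε) ^ 2 * ((observationDensity S ε n w h + observationDensity S ε' n w h) *
            colDeviation (S.maxPolicy n (w, h)) ^ 2) ≤
        ∑ o, √(observationDensity S ε (n + 1) w (Fin.snoc h o : Fin (n + 1) → Observation) *
          observationDensity S ε' (n + 1) w (Fin.snoc h o : Fin (n + 1) → Observation)) := by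
      intro h
      have hp := observationDensity_nonneg S hε n w h
      have hq := observationDensity_nonneg S hε' n w h
      have haff := one_sub_le_sum_sqrt_observationProb hε hε' (S.minPolicy n (w, h))
        (S.maxPolicy n (w, h))
      simp only [observationDensity_snoc, mul_mul_mul_comm _ (observationProb _ _ _ _),
        Real.sqrt_mul (mul_nonneg hp hq), ← Finset.mul_sum]
      generalize observationDensity S ε n w h = x at *
      generalize observationDensity S ε' n w h = y at *
      generalize colDeviation (S.maxPolicy n (w, h)) = v at *
      have hs : √(x * y) ≤ (x + y) / 2 := by
        rw [Real.sqrt_mul hp]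
        nlinarith [Real.sq_sqrt hp, Real.sq_sqrt hq, sq_nonneg (√x - √y)]
      have hv : 0 ≤ (ε' - ε) ^ 2 * v ^ 2 := by positivity
      have h1 := mul_le_mul_of_nonneg_left haff (Real.sqrt_nonneg (x * y))
      have h2 := mul_le_mul_of_nonneg_right hs hv
      nlinarith
    have hsum := Finset.sum_le_sum fun h (_ : h ∈ Finset.univ) => hstep h
    rw [Finset.sum_sub_distrib, ← Finset.mul_sum] at hsum
    linarith

theorem three_quarters_le_sum_observationDensity (S : LearningSequence W) {ε ε' : ℝ}
    (hε : ε ∈ Set.Icc (-1 / 12 : ℝ) (1 / 12)) (hε' : ε' ∈ Set.Icc (-1 / 12 : ℝ) (1 / 12))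
    (w : W) (n : ℕ) (A : Set (Fin n → Observation)) [DecidablePred (· ∈ A)] :
    3 / 4 ≤ (∑ h, if h ∈ A then observationDensity S ε n w h else observationDensity S ε' n w h) +
      4 * (ε' - ε) ^ 2 * ∑ i ∈ Finset.range n, ∑ h,
        (observationDensity S ε i w h + observationDensity S ε' i w h) *
          colDeviation (S.maxPolicy i (w, h)) ^ 2 := by
  have h1 := one_sub_le_sum_sqrt_observationDensity S hε hε' w n
  have h2 : ∑ h, (2 * √(observationDensity S ε n w h * observationDensity S ε' n w h) -
      5 / 8 * (observationDensity S ε n w h + observationDensity S ε' n w h)) ≤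
      ∑ h, if h ∈ A then observationDensity S ε n w h else observationDensity S ε' n w h := by
    refine Finset.sum_le_sum fun h _ => ?_
    have hp := observationDensity_nonneg S hε n w h
    have hq := observationDensity_nonneg S hε' n w h
    split_ifs
    · exact two_mul_sqrt_mul_sub_le_left hp hq
    · rw [mul_comm (observationDensity S ε n w h), add_comm (observationDensity S ε n w h)]
      exact two_mul_sqrt_mul_sub_le_left hq hp
  rw [Finset.sum_sub_distrib, ← Finset.mul_sum, ← Finset.mul_sum, Finset.sum_add_distrib,
    sum_observationDensity, sum_observationDensity] at h2
  linarith

/-- Le Cam's two-point bound: the runs in `M^ε` and `M^ε'` cannot be told apart from the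
observations as long as the policies of the max-player stay close to the uniform one. -/
theorem three_quarters_le_measure_add (S : LearningSequence W) (ρ : Measure W)
    [IsProbabilityMeasure ρ] {ε ε' : ℝ} (hε : ε ∈ Set.Icc (-1 / 12 : ℝ) (1 / 12))
    (hε' : ε' ∈ Set.Icc (-1 / 12 : ℝ) (1 / 12)) {n : ℕ} {A : Set (W × (Fin n → Observation))}
    (hA : MeasurableSet A) :
    ENNReal.ofReal (3 / 4) ≤ runLaw S ρ ε n (observed ⁻¹' A) + runLaw S ρ ε' n (observed ⁻¹' Aᶜ) +
      ENNReal.ofReal (4 * (ε' - ε) ^ 2) * ∑ i ∈ Finset.range n,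
        (∫⁻ z, ENNReal.ofReal (colDeviation (S.maxPolicy i (observed z)) ^ 2) ∂runLaw S ρ ε i +
         ∫⁻ z, ENNReal.ofReal (colDeviation (S.maxPolicy i (observed z)) ^ 2)
          ∂runLaw S ρ ε' i) := by
  classical
  have hv : ∀ i, Measurable fun z : W × (Fin i → Observation) =>
      ENNReal.ofReal (colDeviation (S.maxPolicy i z) ^ 2) := fun i =>
    ENNReal.measurable_ofReal.comp
      ((measurable_colDeviation.comp (S.measurable_maxPolicy i)).pow_const 2)
  have hind : ∀ (e : ℝ) (B : Set (W × (Fin n → Observation))), MeasurableSet B →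
      runLaw S ρ e n (observed ⁻¹' B) = ∫⁻ z, B.indicator 1 (observed z) ∂runLaw S ρ e n := by
    intro e B hB
    rw [← lintegral_indicator_one (measurable_observed hB)]
    rfl
  rw [hind ε A hA, hind ε' Aᶜ hA.compl,
    lintegral_runLaw_observed S ρ hε (measurable_one.indicator hA),
    lintegral_runLaw_observed S ρ hε' (measurable_one.indicator hA.compl)]
  simp only [fun i => lintegral_runLaw_observed S ρ hε (hv i),
    fun i => lintegral_runLaw_observed S ρ hε' (hv i)]
  have hm1 : ∀ e, Measurable fun w => ∑ h, ENNReal.ofReal (observationDensity S e n w h) *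
      A.indicator 1 (w, h) := fun e => Finset.measurable_sum _ fun h _ =>
    (ENNReal.measurable_ofReal.comp (measurable_observationDensity S e n h)).mul
      ((measurable_one.indicator hA).comp measurable_prodMk_right)
  have hm2 : ∀ e i, Measurable fun w => ∑ h, ENNReal.ofReal (observationDensity S e i w h) *
      ENNReal.ofReal (colDeviation (S.maxPolicy i (w, h)) ^ 2) := fun e i =>
    Finset.measurable_sum _ fun h _ =>
      (ENNReal.measurable_ofReal.comp (measurable_observationDensity S e i h)).mul
      ((hv i).comp measurable_prodMk_right)
  have hadd : ∀ i, ∫⁻ w, ∑ h, ENNReal.ofReal (observationDensity S ε i w h) *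
        ENNReal.ofReal (colDeviation (S.maxPolicy i (w, h)) ^ 2) ∂ρ +
      ∫⁻ w, ∑ h, ENNReal.ofReal (observationDensity S ε' i w h) *
        ENNReal.ofReal (colDeviation (S.maxPolicy i (w, h)) ^ 2) ∂ρ = _ :=
    fun i => (lintegral_add_left (hm2 ε i) _).symm
  have hm3 : ∀ i, Measurable fun w =>
      ∑ h, ENNReal.ofReal (observationDensity S ε i w h) *
        ENNReal.ofReal (colDeviation (S.maxPolicy i (w, h)) ^ 2) +
      ∑ h, ENNReal.ofReal (observationDensity S ε' i w h) *
        ENNReal.ofReal (colDeviation (S.maxPolicy i (w, h)) ^ 2) :=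
    fun i => (hm2 ε i).add (hm2 ε' i)
  simp only [hadd]
  rw [← lintegral_finsetSum _ fun i _ => hm3 i,
    ← lintegral_const_mul _ (Finset.measurable_sum _ fun i _ => hm3 i),
    ← lintegral_add_left (hm1 ε), ← lintegral_add_right _ (Measurable.const_mul
      (Finset.measurable_sum _ fun i _ => hm3 i) _)]
  -- The internal randomness has the same law in both games, so everything is now an integral
  -- against `ρ` and the bound can be checked for each fixed `w`.
  calc ENNReal.ofReal (3 / 4) = ∫⁻ _, ENNReal.ofReal (3 / 4) ∂ρ := by simp
    _ ≤ _ := lintegral_mono fun w => ?_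
  have hp := fun e (he : e ∈ Set.Icc (-1 / 12 : ℝ) (1 / 12)) m h =>
    observationDensity_nonneg S he m w h
  have key := three_quarters_le_sum_observationDensity S hε hε' w n {h | (w, h) ∈ A}
  refine (ENNReal.ofReal_le_ofReal key).trans ?_
  rw [ENNReal.ofReal_add (Finset.sum_nonneg fun h _ => by
      split_ifs
      exacts [hp _ hε _ _, hp _ hε' _ _])
    (mul_nonneg (by positivity) (Finset.sum_nonneg fun i _ => Finset.sum_nonneg fun h _ =>
      mul_nonneg (add_nonneg (hp _ hε _ _) (hp _ hε' _ _)) (sq_nonneg _))),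
    ENNReal.ofReal_mul (by positivity),
    ENNReal.ofReal_sum_of_nonneg fun i _ => Finset.sum_nonneg fun h _ =>
      mul_nonneg (add_nonneg (hp _ hε _ _) (hp _ hε' _ _)) (sq_nonneg _),
    ENNReal.ofReal_sum_of_nonneg fun h _ => by
      split_ifs
      exacts [hp _ hε _ _, hp _ hε' _ _]]
  refine add_le_add (le_of_eq ?_) (mul_le_mul_right (Finset.sum_le_sum fun i _ => le_of_eq ?_) _)
  · rw [← Finset.sum_add_distrib]
    refine Finset.sum_congr rfl fun h _ => ?_
    by_cases hw : (w, h) ∈ A <;> simp [hw]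
  · rw [ENNReal.ofReal_sum_of_nonneg fun h _ =>
      mul_nonneg (add_nonneg (hp _ hε _ _) (hp _ hε' _ _)) (sq_nonneg _),
      ← Finset.sum_add_distrib]
    refine Finset.sum_congr rfl fun h _ => ?_
    rw [ENNReal.ofReal_mul (add_nonneg (hp _ hε _ _) (hp _ hε' _ _)),
      ENNReal.ofReal_add (hp _ hε _ _) (hp _ hε' _ _), add_mul]

end LearningSequences

/-! ### The rate -/

/-- Bernoulli's inequality gives `(n+1)^r - n^r ≥ r (n+1)^(r-1)`, which telescopes; the factor `2`
bounds `1/r`. -/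
theorem sum_range_rpow_le {r : ℝ} (h1 : 1 / 2 ≤ r) (h2 : r ≤ 1) (n : ℕ) :
    ∑ i ∈ Finset.range n, ((i : ℝ) + 1) ^ (r - 1) ≤ 2 * (n : ℝ) ^ r := by
  induction n with
  | zero => simp [Real.zero_rpow (by linarith : r ≠ 0)]
  | succ n ih =>
    rw [Finset.sum_range_succ]
    have hn : (0 : ℝ) < n + 1 := by positivity
    have hb := rpow_one_add_le_one_add_mul_self (s := -1 / ((n : ℝ) + 1)) (p := r)
      (by rw [le_div_iff₀ hn]; linarith [(Nat.cast_nonneg n : (0 : ℝ) ≤ n)]) (by linarith) h2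
    have he : 1 + -1 / ((n : ℝ) + 1) = n / (n + 1) := by field_simp; ring
    rw [he, Real.div_rpow (Nat.cast_nonneg n) hn.le, div_le_iff₀ (by positivity)] at hb
    have hs : ((n : ℝ) + 1) ^ (r - 1) = (n + 1 : ℝ) ^ r / (n + 1) := by
      rw [Real.rpow_sub_one hn.ne']
    have hpos : 0 ≤ ((n : ℝ) + 1) ^ (r - 1) := by positivity
    have hc : (1 + r * (-1 / ((n : ℝ) + 1))) * (n + 1 : ℝ) ^ r =
        (n + 1 : ℝ) ^ r - r * ((n : ℝ) + 1) ^ (r - 1) := by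
      rw [hs]
      field_simp
      ring
    push_cast
    nlinarith

theorem lowerRate_nonneg (p : ℝ) (t : ℕ) : 0 ≤ lowerRate p t := by
  unfold lowerRate
  positivity

theorem lowerRate_rpow {p : ℝ} (hp : 0 < p) (t : ℕ) :
    lowerRate p t ^ p = 1 / 4 * ((t : ℝ) ^ (-1 / (2 + p)) / 118) ^ p := by
  rw [lowerRate, div_mul_eq_mul_div, mul_div_assoc, Real.mul_rpow (by positivity) (by positivity),
    ← Real.rpow_mul (by norm_num), div_mul_cancel₀ _ hp.ne', Real.rpow_neg_one]
  norm_num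

/-- A time horizon that is adapted to the distance `d` of two games. -/
theorem exists_horizon {p d : ℝ} (hp : 0 < p) (N : ℕ) (hd : 0 < d) (hdN : d ≤ 1 / (16 * (N + 1))) :
    ∃ n : ℕ, N ≤ n + 1 ∧ ((n + 1 : ℕ) : ℝ) ^ (-1 / (2 + p)) ≤ 16 * d ∧
      8 * d ≤ ((n + 1 : ℕ) : ℝ) ^ (-1 / (2 + p)) := by
  have hN : (0 : ℝ) < N + 1 := by positivity
  have hdiv : ((N : ℝ) + 1) ≤ (16 * d)⁻¹ := by
    rw [le_inv_comm₀ hN (by positivity)]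
    rw [le_div_iff₀ (by positivity)] at hdN
    rw [← one_div, le_div_iff₀ hN]
    linarith
  have hone : 1 ≤ (16 * d)⁻¹ := by linarith [(Nat.cast_nonneg N : (0 : ℝ) ≤ N)]
  have hX : (16 * d)⁻¹ ≤ (16 * d)⁻¹ ^ (2 + p) := by
    conv_lhs => rw [← Real.rpow_one (16 * d)⁻¹]
    exact Real.rpow_le_rpow_of_exponent_le hone (by linarith)
  -- The horizon `⌊X⌋ + 1` lies between `X` and `2^(2+p) X = (8 * d)⁻¹ ^ (2 + p)`; since `X ≥ 1`,
  -- the factor `2^(2+p) ≥ 2` absorbs the rounding.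
  set X := (16 * d)⁻¹ ^ (2 + p) with hXdef
  have hX0 : 0 < X := by linarith
  have hneg : -1 / (2 + p) ≤ 0 := div_nonpos_of_nonpos_of_nonneg (by norm_num) (by linarith)
  have hmul : (2 + p) * (-1 / (2 + p)) = -1 := mul_div_cancel₀ _ (by linarith)
  have hT1 : X ≤ ((⌊X⌋₊ + 1 : ℕ) : ℝ) := by exact_mod_cast (Nat.lt_floor_add_one X).le
  have hT2 : ((⌊X⌋₊ + 1 : ℕ) : ℝ) ≤ (8 * d)⁻¹ ^ (2 + p) := by
    have h1 : ((⌊X⌋₊ + 1 : ℕ) : ℝ) ≤ X + 1 := by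
      push_cast
      linarith [Nat.floor_le hX0.le]
    have h2 : (8 * d)⁻¹ = 2 * (16 * d)⁻¹ := by field_simp; norm_num
    have h3 : (2 : ℝ) ≤ 2 ^ (2 + p) := by
      conv_lhs => rw [← Real.rpow_one 2]
      exact Real.rpow_le_rpow_of_exponent_le (by norm_num) (by linarith)
    rw [h2, Real.mul_rpow (by norm_num) (by positivity), ← hXdef]
    nlinarith
  refine ⟨⌊X⌋₊, ?_, ?_, ?_⟩
  · have : (N : ℝ) ≤ ((⌊X⌋₊ + 1 : ℕ) : ℝ) := by linarith
    exact_mod_cast this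
  · refine (Real.rpow_le_rpow_of_nonpos hX0 hT1 hneg).trans (le_of_eq ?_)
    rw [hXdef, ← Real.rpow_mul (by positivity), hmul, Real.rpow_neg_one, inv_inv]
  · refine le_trans (le_of_eq ?_) (Real.rpow_le_rpow_of_nonpos (by positivity) hT2 hneg)
    rw [← Real.rpow_mul (by positivity), hmul, Real.rpow_neg_one, inv_inv]

/-- Only countably many points of a set of reals are isolated in it from the right. -/
theorem exists_mem_forall_gt_exists_mem_Ioo {s : Set ℝ} (hs : ¬ s.Countable) :
    ∃ x ∈ s, ∀ y > x, ∃ z ∈ s, z ∈ Set.Ioo x y := by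
  by_contra! h
  refine hs ((countable_setOfPred_isolated_right_within (s := s)).mono fun x hx => ?_)
  obtain ⟨y, hy, hxy⟩ := h x hx
  refine ⟨hx, empty_mem_iff_bot.1 (mem_nhdsWithin.2 ⟨Set.Iio y, isOpen_Iio, hy, ?_⟩)⟩
  exact fun z hz => hxy z hz.2.1 ⟨hz.2.2, hz.1⟩

/-! ### Consequences of the rate for both deviations, and the contradiction. -/

section LearningSequences

variable {W : Type*} [MeasurableSpace W]

theorem lintegral_enorm_exploitabilityGap_rpow_le {S : LearningSequence W} {ρ : Measure W}
    {ε p c : ℝ} (hp : 0 < p) (hc : 0 ≤ c) {n : ℕ} (h : gapNorm S ρ ε p n ≤ ENNReal.ofReal c) :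
    ∫⁻ z, ‖exploitabilityGap (gameMatrix ε) (S.minPolicy n (observed z))
      (S.maxPolicy n (observed z))‖ₑ ^ p ∂runLaw S ρ ε n ≤ ENNReal.ofReal (c ^ p) := by
  rw [gapNorm, eLpNorm_eq_lintegral_rpow_enorm_toReal (by simpa using hp) ENNReal.ofReal_ne_top,
    ENNReal.toReal_ofReal hp.le, one_div, ENNReal.rpow_inv_le_iff hp] at h
  rwa [← ENNReal.ofReal_rpow_of_nonneg hc hp.le]

theorem ofReal_mul_rpow_le_enorm_rpow {a x y p : ℝ} (ha : 0 ≤ a) (hx : 0 ≤ x) (hxy : x ≤ y)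
    (hp : 0 < p) : ENNReal.ofReal ((a * x) ^ p) ≤ ENNReal.ofReal (a ^ p) * ‖y‖ₑ ^ p := by
  rw [Real.enorm_eq_ofReal (hx.trans hxy), ENNReal.ofReal_rpow_of_nonneg (hx.trans hxy) hp.le,
    ← ENNReal.ofReal_mul (by positivity), ← Real.mul_rpow ha (hx.trans hxy)]
  exact ENNReal.ofReal_le_ofReal (Real.rpow_le_rpow (mul_nonneg ha hx)
    (mul_le_mul_of_nonneg_left hxy ha) hp.le)

theorem lintegral_sq_colDeviation_le {S : LearningSequence W} {ρ : Measure W}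
    {ε p : ℝ} (hε : ε ∈ Set.Icc (-1 / 12 : ℝ) (1 / 12)) (hp₀ : 0 < p) (hp₂ : p ≤ 2) {n : ℕ}
    (h : gapNorm S ρ ε p n ≤ ENNReal.ofReal (lowerRate p (n + 1))) :
    ∫⁻ z, ENNReal.ofReal (colDeviation (S.maxPolicy n (observed z)) ^ 2) ∂runLaw S ρ ε n ≤
      ENNReal.ofReal (1 / 16 * ((n : ℝ) + 1) ^ (2 / (2 + p) - 1)) := by
  have hpt : ∀ z : W × (Fin n → Round),
      ENNReal.ofReal (colDeviation (S.maxPolicy n (observed z)) ^ 2) ≤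
      ENNReal.ofReal (1 / 4) * (ENNReal.ofReal (12 ^ p) *
        ‖exploitabilityGap (gameMatrix ε) (S.minPolicy n (observed z))
          (S.maxPolicy n (observed z))‖ₑ ^ p) := by
    intro z
    have hgap := deviations_le_exploitabilityGap hε (S.minPolicy n (observed z))
      (S.maxPolicy n (observed z))
    have hv := abs_colDeviation_le (S.maxPolicy n (observed z))
    generalize colDeviation (S.maxPolicy n (observed z)) = v at *
    refine le_trans ?_ (mul_le_mul_right (ofReal_mul_rpow_le_enorm_rpow (by norm_num)
      (by positivity : 0 ≤ |v| / 6) ((le_add_of_nonneg_left (abs_nonneg _)).trans hgap) hp₀) _)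
    rw [← ENNReal.ofReal_mul (by norm_num)]
    refine ENNReal.ofReal_le_ofReal ?_
    -- The factor `12` normalizes the base to `2|v| ≤ 1`, so that lowering the exponent from `2` to
    -- `p` increases the power.
    have h1 : (12 * (|v| / 6)) ^ (2 : ℝ) ≤ (12 * (|v| / 6)) ^ p :=
      Real.rpow_le_rpow_of_exponent_ge' (by positivity) (by linarith) hp₀.le hp₂
    have h2 : (12 * (|v| / 6)) ^ (2 : ℝ) = 4 * v ^ 2 := by
      rw [Real.rpow_two, ← sq_abs v]
      ring
    linarith
  refine (lintegral_mono hpt).trans ?_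
  rw [lintegral_const_mul' _ _ ENNReal.ofReal_ne_top, lintegral_const_mul' _ _ ENNReal.ofReal_ne_top]
  refine (mul_le_mul_right (mul_le_mul_right
    (lintegral_enorm_exploitabilityGap_rpow_le hp₀ (lowerRate_nonneg p _) h) _) _).trans ?_
  rw [← ENNReal.ofReal_mul (by positivity), ← ENNReal.ofReal_mul (by norm_num), lowerRate_rpow hp₀]
  refine ENNReal.ofReal_le_ofReal ?_
  have hT : (0 : ℝ) < (n : ℝ) + 1 := by positivity
  have h1 : (12 : ℝ) ^ p * ((((n + 1 : ℕ) : ℝ) ^ (-1 / (2 + p)) / 118) ^ p) ≤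
      ((n : ℝ) + 1) ^ (2 / (2 + p) - 1) := by
    rw [← Real.mul_rpow (by norm_num) (by positivity)]
    have h2 : ((n : ℝ) + 1) ^ (2 / (2 + p) - 1) = (((n : ℝ) + 1) ^ (-1 / (2 + p))) ^ p := by
      rw [← Real.rpow_mul hT.le]
      congr 1
      field_simp
      ring
    rw [h2]
    push_cast
    refine Real.rpow_le_rpow (by positivity) ?_ hp₀.le
    have : 0 ≤ ((n : ℝ) + 1) ^ (-1 / (2 + p)) := by positivity
    linarith
  linarith

theorem lintegral_sq_colDeviation_le_quarter (S : LearningSequence W) (ρ : Measure W)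
    [IsProbabilityMeasure ρ] (ε : ℝ) (n : ℕ) :
    ∫⁻ z, ENNReal.ofReal (colDeviation (S.maxPolicy n (observed z)) ^ 2) ∂runLaw S ρ ε n ≤
      ENNReal.ofReal (1 / 4) := by
  calc _ ≤ ∫⁻ _, ENNReal.ofReal (1 / 4) ∂runLaw S ρ ε n := lintegral_mono fun z => by
        refine ENNReal.ofReal_le_ofReal ?_
        have hv := abs_colDeviation_le (S.maxPolicy n (observed z))
        rw [← sq_abs]
        nlinarith [abs_nonneg (colDeviation (S.maxPolicy n (observed z)))]
    _ = _ := by simp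

theorem sum_lintegral_sq_colDeviation_le {S : LearningSequence W} {ρ : Measure W}
    [IsProbabilityMeasure ρ] {ε p : ℝ} (hε : ε ∈ Set.Icc (-1 / 12 : ℝ) (1 / 12)) (hp₀ : 0 < p)
    (hp₂ : p ≤ 2) {N : ℕ}
    (h : ∀ n : ℕ, N ≤ n + 1 → gapNorm S ρ ε p n ≤ ENNReal.ofReal (lowerRate p (n + 1))) (n : ℕ) :
    ∑ i ∈ Finset.range n,
      ∫⁻ z, ENNReal.ofReal (colDeviation (S.maxPolicy i (observed z)) ^ 2) ∂runLaw S ρ ε i ≤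
      ENNReal.ofReal ((N : ℝ) / 4 + (n : ℝ) ^ (2 / (2 + p)) / 8) := by
  have hr1 : 1 / 2 ≤ 2 / (2 + p) := by
    rw [div_le_div_iff₀ (by norm_num) (by linarith)]
    linarith
  have hr2 : 2 / (2 + p) ≤ 1 := by
    rw [div_le_one (by linarith)]
    linarith
  -- Before the rate takes effect only `v² ≤ 1/4` is known; these rounds account for `N / 4`.
  have hi : ∀ i : ℕ,
      ∫⁻ z, ENNReal.ofReal (colDeviation (S.maxPolicy i (observed z)) ^ 2) ∂runLaw S ρ ε i ≤
      ENNReal.ofReal ((if i < N then 1 / 4 else 0) +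
        1 / 16 * ((i : ℝ) + 1) ^ (2 / (2 + p) - 1)) := by
    intro i
    split_ifs with hiN
    · exact (lintegral_sq_colDeviation_le_quarter S ρ ε i).trans
        (ENNReal.ofReal_le_ofReal (le_add_of_nonneg_right (by positivity)))
    · rw [zero_add]
      exact lintegral_sq_colDeviation_le hε hp₀ hp₂ (h i (by omega))
  refine (Finset.sum_le_sum fun i _ => hi i).trans ?_
  rw [← ENNReal.ofReal_sum_of_nonneg fun i _ =>
    add_nonneg (by split_ifs <;> norm_num) (by positivity)]
  refine ENNReal.ofReal_le_ofReal ?_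
  rw [Finset.sum_add_distrib, ← Finset.mul_sum, Finset.sum_ite, Finset.sum_const_zero, add_zero,
    Finset.sum_const, nsmul_eq_mul]
  have hcard : (((Finset.range n).filter fun i => i < N).card : ℝ) ≤ N := by
    have hsub : ((Finset.range n).filter fun i => i < N) ⊆ Finset.range N := fun i hi =>
      Finset.mem_range.2 (Finset.mem_filter.1 hi).2
    exact_mod_cast (Finset.card_le_card hsub).trans (Finset.card_range N).le
  linarith [sum_range_rpow_le hr1 hr2 n]

/-- Markov's inequality for the `p`-th power of the gap. The factor `4^(-1/p)` of the rate becomes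
the `1/4`, and what remains is at most `1` because `5 * 16 ≤ 118`. -/
theorem runLaw_le_rowDeviation_le_quarter {S : LearningSequence W} {ρ : Measure W}
    {ε p d : ℝ} (hε : ε ∈ Set.Icc (-1 / 12 : ℝ) (1 / 12)) (hp : 0 < p) {n : ℕ}
    (h : gapNorm S ρ ε p n ≤ ENNReal.ofReal (lowerRate p (n + 1))) (hd : 0 < d)
    (hdn : ((n + 1 : ℕ) : ℝ) ^ (-1 / (2 + p)) ≤ 16 * d)
    {A : Set (W × (Fin n → Observation))} (hA : MeasurableSet A)
    (hAd : ∀ z ∈ A, d / 5 ≤ |rowDeviation ε (S.minPolicy n z)|) :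
    runLaw S ρ ε n (observed ⁻¹' A) ≤ ENNReal.ofReal (1 / 4) := by
  rw [← lintegral_indicator_one (measurable_observed hA)]
  calc _ ≤ ∫⁻ z, ENNReal.ofReal ((5 / d) ^ p) * ‖exploitabilityGap (gameMatrix ε)
        (S.minPolicy n (observed z)) (S.maxPolicy n (observed z))‖ₑ ^ p ∂runLaw S ρ ε n :=
      lintegral_mono fun z => ?_
    _ ≤ ENNReal.ofReal ((5 / d) ^ p) * ENNReal.ofReal (lowerRate p (n + 1) ^ p) := by
      rw [lintegral_const_mul' _ _ ENNReal.ofReal_ne_top]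
      exact mul_le_mul_right
        (lintegral_enorm_exploitabilityGap_rpow_le hp (lowerRate_nonneg p _) h) _
    _ ≤ ENNReal.ofReal (1 / 4) := by
      rw [← ENNReal.ofReal_mul (by positivity), lowerRate_rpow hp]
      refine ENNReal.ofReal_le_ofReal ?_
      have h1 : (5 / d) ^ p * (((n + 1 : ℕ) : ℝ) ^ (-1 / (2 + p)) / 118) ^ p ≤ 1 := by
        rw [← Real.mul_rpow (by positivity) (by positivity)]
        refine Real.rpow_le_one (by positivity) ?_ hp.le
        rw [div_mul_div_comm, div_le_one (by positivity)]
        linarith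
      linarith
  by_cases hz : observed z ∈ A
  · have hgap := deviations_le_exploitabilityGap hε (S.minPolicy n (observed z))
      (S.maxPolicy n (observed z))
    have hle := hAd _ hz
    refine le_trans (le_of_eq ?_) (ofReal_mul_rpow_le_enorm_rpow (a := 5 / d) (x := d / 5)
      (by positivity) (by positivity) ((le_add_of_le_of_nonneg hle (by positivity)).trans hgap) hp)
    rw [Set.indicator_of_mem (Set.mem_preimage.2 hz), div_mul_div_cancel₀ hd.ne']
    simp
  · rw [Set.indicator_of_notMem (by exact hz)]
    exact zero_le

theorem not_forall_gapNorm_le_of_close (S : LearningSequence W) (ρ : Measure W)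
    [IsProbabilityMeasure ρ] {ε ε' p : ℝ} (hε : ε ∈ Set.Icc (-1 / 12 : ℝ) (1 / 12))
    (hε' : ε' ∈ Set.Icc (-1 / 12 : ℝ) (1 / 12)) (hp₀ : 0 < p) (hp₂ : p ≤ 2) {N : ℕ}
    (hlt : ε < ε') (hclose : ε' - ε ≤ 1 / (16 * (N + 1)))
    (h : ∀ n : ℕ, N ≤ n + 1 → gapNorm S ρ ε p n ≤ ENNReal.ofReal (lowerRate p (n + 1)))
    (h' : ∀ n : ℕ, N ≤ n + 1 → gapNorm S ρ ε' p n ≤ ENNReal.ofReal (lowerRate p (n + 1))) :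
    False := by
  have hd : 0 < ε' - ε := sub_pos.2 hlt
  obtain ⟨n, hNn, hn1, hn2⟩ := exists_horizon hp₀ N hd hclose
  set A : Set (W × (Fin n → Observation)) :=
    {z | (ε' - ε) / 5 ≤ |rowDeviation ε (S.minPolicy n z)|}
  have hA : MeasurableSet A := measurableSet_le measurable_const
    ((measurable_rowDeviation ε).comp (S.measurable_minPolicy n)).abs
  have hP := runLaw_le_rowDeviation_le_quarter hε hp₀ (h n hNn) hd hn1 hA fun z hz => hz
  have hP' := runLaw_le_rowDeviation_le_quarter hε' hp₀ (h' n hNn) hd hn1 hA.compl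
    fun z hz => le_abs_rowDeviation_of_lt hε hε' _ (not_le.1 hz)
  have hV := sum_lintegral_sq_colDeviation_le hε hp₀ hp₂ h n
  have hV' := sum_lintegral_sq_colDeviation_le hε' hp₀ hp₂ h' n
  have key := three_quarters_le_measure_add S ρ hε hε' hA
  rw [Finset.sum_add_distrib] at key
  have hfin := key.trans (add_le_add (add_le_add hP hP')
    (mul_le_mul_right (add_le_add hV hV') (ENNReal.ofReal (4 * (ε' - ε) ^ 2))))
  rw [← ENNReal.ofReal_add (by norm_num) (by norm_num),
    ← ENNReal.ofReal_add (by positivity) (by positivity), ← ENNReal.ofReal_mul (by positivity),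
    ← ENNReal.ofReal_add (by norm_num) (by positivity),
    ENNReal.ofReal_le_ofReal_iff (by positivity)] at hfin
  have hpow : (ε' - ε) ^ 2 * (n : ℝ) ^ (2 / (2 + p)) ≤ 1 / 64 := by
    have hT : (0 : ℝ) < (n + 1 : ℕ) := by positivity
    have h1 : (n : ℝ) ^ (2 / (2 + p)) ≤ ((n + 1 : ℕ) : ℝ) ^ (2 / (2 + p)) :=
      Real.rpow_le_rpow (by positivity) (by push_cast; linarith) (by positivity)
    have h2 : (((n + 1 : ℕ) : ℝ) ^ (-1 / (2 + p))) ^ 2 * ((n + 1 : ℕ) : ℝ) ^ (2 / (2 + p)) = 1 := by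
      rw [← Real.rpow_natCast, ← Real.rpow_mul hT.le, ← Real.rpow_add hT]
      convert Real.rpow_zero _ using 2
      push_cast
      ring
    have h3 : (8 * (ε' - ε)) ^ 2 ≤ (((n + 1 : ℕ) : ℝ) ^ (-1 / (2 + p))) ^ 2 :=
      pow_le_pow_left₀ (by positivity) hn2 2
    have h4 := mul_le_mul h3 h1 (by positivity) (by positivity)
    rw [h2] at h4
    linarith
  have hN : (ε' - ε) ^ 2 * N ≤ 1 / 256 := by
    have hN0 : (0 : ℝ) ≤ N := Nat.cast_nonneg N
    rw [le_div_iff₀ (by positivity)] at hclose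
    nlinarith [mul_nonneg hd.le hN0]
  -- With `d = ε' - ε`, `hfin` reads `3/4 ≤ 1/2 + 2 d² N + d² n^(2/(2+p))`, whereas the last two
  -- terms are at most `1/128 + 1/64`.
  linarith

theorem not_forall_hasAsymptoticLastIterateRate (S : LearningSequence W) (ρ : Measure W)
    [IsProbabilityMeasure ρ] {p : ℝ} (hp₀ : 0 < p) (hp₂ : p ≤ 2) :
    ¬ ∀ ε ∈ Set.Icc (-1 / 12 : ℝ) (1 / 12),
      HasAsymptoticLastIterateRate S ρ ε p (lowerRate p) := by
  intro hall
  let E : ℕ → Set ℝ := fun N => {ε | ε ∈ Set.Icc (-1 / 12 : ℝ) (1 / 12) ∧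
    ∀ n : ℕ, N ≤ n + 1 → gapNorm S ρ ε p n ≤ ENNReal.ofReal (lowerRate p (n + 1))}
  obtain ⟨N, hN⟩ : ∃ N, ¬ (E N).Countable := by
    by_contra! hE
    have hunc : ¬ (Set.Icc (-1 / 12 : ℝ) (1 / 12)).Countable := by
      rw [← Cardinal.le_aleph0_iff_set_countable, Cardinal.mk_Icc_real (by norm_num), not_le]
      exact Cardinal.aleph0_lt_continuum
    refine hunc ((Set.countable_iUnion hE).mono fun ε hε => ?_)
    obtain ⟨N, hN⟩ := hall ε hε
    exact Set.mem_iUnion.2 ⟨N, hε, hN⟩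
  obtain ⟨ε, hε, hacc⟩ := exists_mem_forall_gt_exists_mem_Ioo hN
  obtain ⟨ε', hε', hlt, hclose⟩ := hacc (ε + 1 / (16 * (N + 1)))
    (lt_add_of_pos_right _ (by positivity))
  exact not_forall_gapNorm_le_of_close S ρ hε.1 hε'.1 hp₀ hp₂ hlt (by linarith) hε.2 hε'.2

end LearningSequences

end

theorem theorem1 {W : Type*} [MeasurableSpace W] (ρ : Measure W) [IsProbabilityMeasure ρ]
    (S : LearningSequence W) (p : ℝ) (hp₀ : 0 < p) (hp₂ : p ≤ 2) :
    (¬ ∀ ε ∈ Set.Icc (-1 / 12 : ℝ) (1 / 12), HasLastIterateRate S ρ ε p (lowerRate p)) ∧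
    (¬ ∀ ε ∈ Set.Icc (-1 / 12 : ℝ) (1 / 12), HasAsymptoticLastIterateRate S ρ ε p (lowerRate p)) ∧
    (∀ g : ℕ → ℝ,
      (∀ ε ∈ Set.Icc (-1 / 12 : ℝ) (1 / 12), HasAsymptoticLastIterateRate S ρ ε p g) →
      ∃ᶠ t in atTop, lowerRate p t < g t) := by
  have hasym := not_forall_hasAsymptoticLastIterateRate S ρ hp₀ hp₂
  -- If `g` is eventually at most `lowerRate p`, convergence of rate `g` implies convergence of rate
  -- `lowerRate p` after enlarging `T₀`.
  refine ⟨fun h => hasym fun ε hε => ⟨0, fun n _ => h ε hε n⟩, hasym, fun g hg hfreq => hasym ?_⟩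
  obtain ⟨M, hM⟩ := eventually_atTop.1 hfreq
  intro ε hε
  obtain ⟨T, hT⟩ := hg ε hε
  exact ⟨max T M, fun n hn => (hT n (le_of_max_le_left hn)).trans
    (ENNReal.ofReal_le_ofReal (not_lt.1 (hM (n + 1) (le_of_max_le_right hn))))⟩
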